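/- Let $n\ge 1$ and let $\mathbb H^n=\mathbb C^n\times\mathbb R$ be the Heisenberg group with product $(z,t)(w,s)=\big(z+w,\;t+s+\tfrac12\operatorname{Im}(z\cdot\bar w)\big)$ and Haar measure $dz\,dt$. Let $\mathbb R^*=\mathbb R\setminus\{0\}$ carry the measure $d\mu(\lambda)=(2\pi)^{-n-1}|\lambda|^n\,d\lambda$. For $\lambda\in\mathbb R^*$ let $\pi_\lambda$ be the representation of $\mathbb H^n$ on $L^2(\mathbb R^n)$ given, with $z=x+iy$, by $$\pi_\lambda(z,t)\varphi(\xi)=e^{i\lambda t}\,e^{i\lambda(x\cdot\xi+\frac12x\cdot y)}\,\varphi(\xi+y),$$ and for $f\in L^1(\mathbb H^n)$ let $\hat f(\lambda)=\int_{\mathbb H^n}f(z,t)\,\pi_\lambda(z,t)\,dz\,dt$ (a strong operator integral). Put $f^*(z,t)=\overline{f(-z,-t)}$, $(f*g)(z,t)=\int_{\mathbb H^n}f\big((z,t)(-w,-s)\big)\,g(w,s)\,dw\,ds$ and $(R_{(z,t)}f)(w,s)=f\big((w,s)(z,t)\big)$. Let $L^\infty(\mathbb R^*,B(L^2(\mathbb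 R^n)),d\mu)$ be the space of weakly measurable, essentially bounded functions $\mathbb R^*\to B(L^2(\mathbb R^n))$ modulo equality almost everywhere, with the essential supremum norm. **Theorem 4.2.** Let $T:L^1(\mathbb H^n)\to L^\infty(\mathbb R^*,B(L^2(\mathbb R^n)),d\mu)$ be a nonzero continuous linear map such that, for all $f,g\in L^1(\mathbb H^n)$ and $(z,t)\in\mathbb H^n$, (i) $T(f^*)(\lambda)=(Tf)(\lambda)^*$, (ii) $T(f*g)(\lambda)=(Tf)(\lambda)\,(Tg)(\lambda)$, (iii) $T(R_{(z,t)}f)(\lambda)=(Tf)(\lambda)\,\pi_\lambda(z,t)^*$, each for almost every $\lambda\in\mathbb R^*$ (the exceptional null set may depend on $f,g,(z,t)$). Then: (a) There is an essential support of $T$, that is, a measurable set $A\subseteq\mathbb R^*$ such that every $Tf$ vanishes almost everywhere off $A$ and which, up to null sets, is contained in every measurable set with this property. For every such $A$ and every $f\in L^1(\mathbb H^n)$, $(Tf)(\lambda)=\hat f(\lambda)$ for almost every $\lambda\in A$. (b) Suppose representatives $(Tf)(\lambda)$, defined for every $\lambda\in\mathbb R^*$, can be chosen for all $f\in L^1(\mathbb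 H^n)$ so that they depend linearly on $f$ for each $\lambda$ and (i), (ii), (iii) hold for every $\lambda\in\mathbb R^*$. Then for any such choice, with $A=\{\lambda\in\mathbb R^*:(Tf)(\lambda)\neq0\text{ for some }f\in L^1(\mathbb H^n)\}$, one has $(Tf)(\lambda)=\hat f(\lambda)$ for every $\lambda\in A$ and every $f\in L^1(\mathbb H^n)$. -/

import Mathlib

open MeasureTheory Filter Topology
open scoped ENNReal ComplexConjugate

noncomputable section

/-- The underlying manifold `ℂⁿ × ℝ` of the Heisenberg group of dimension `2n + 1`. -/
def Heisenberg (n : ℕ) : Type := (Fin n → ℂ) × ℝ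

namespace Heisenberg

variable {n : ℕ}

instance : TopologicalSpace (Heisenberg n) := inferInstanceAs (TopologicalSpace ((Fin n → ℂ) × ℝ))

instance : SecondCountableTopology (Heisenberg n) :=
  inferInstanceAs (SecondCountableTopology ((Fin n → ℂ) × ℝ))

/-- Lebesgue measure `dz dt` on `ℂⁿ × ℝ`. -/
instance : MeasureSpace (Heisenberg n) := inferInstanceAs (MeasureSpace ((Fin n → ℂ) × ℝ))

instance : BorelSpace (Heisenberg n) := inferInstanceAs (BorelSpace ((Fin n → ℂ) × ℝ))

instance : SigmaFinite (volume : Measure (Heisenberg n)) :=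
  inferInstanceAs (SigmaFinite (volume : Measure ((Fin n → ℂ) × ℝ)))

/-- `z · w̄ = ∑ⱼ zⱼ w̄ⱼ`. -/
def herm (z w : Fin n → ℂ) : ℂ := ∑ j, z j * conj (w j)

/-- `(z, t)(w, s) = (z + w, t + s + ½ Im (z · w̄))`. -/
instance : Mul (Heisenberg n) where
  mul g h := (g.1 + h.1, g.2 + h.2 + (1 / 2 : ℝ) * (herm g.1 h.1).im)

instance : One (Heisenberg n) where
  one := ((0 : Fin n → ℂ), (0 : ℝ))

instance : Inv (Heisenberg n) where
  inv g := (-g.1, -g.2)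

lemma herm_add_left (z z' w : Fin n → ℂ) : herm (z + z') w = herm z w + herm z' w := by
  simp [herm, add_mul, Finset.sum_add_distrib]

lemma herm_add_right (z w w' : Fin n → ℂ) : herm z (w + w') = herm z w + herm z w' := by
  simp [herm, mul_add, Finset.sum_add_distrib]

lemma herm_neg_self_im (z : Fin n → ℂ) : (herm (-z) z).im = 0 := by
  simp only [herm, Pi.neg_apply, Complex.im_sum]
  refine Finset.sum_eq_zero fun j _ => ?_
  simp [Complex.mul_im]
  ring

lemma ext' {g h : Heisenberg n} (h1 : g.1 = h.1) (h2 : g.2 = h.2) : g = h := Prod.ext h1 h2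

lemma mul_fst (g h : Heisenberg n) : (g * h).1 = g.1 + h.1 := rfl

lemma mul_snd (g h : Heisenberg n) :
    (g * h).2 = g.2 + h.2 + (1 / 2 : ℝ) * (herm g.1 h.1).im := rfl

lemma one_fst : (1 : Heisenberg n).1 = 0 := rfl

lemma one_snd : (1 : Heisenberg n).2 = 0 := rfl

lemma inv_fst (g : Heisenberg n) : (g⁻¹).1 = -g.1 := rfl

lemma inv_snd (g : Heisenberg n) : (g⁻¹).2 = -g.2 := rfl

instance : Group (Heisenberg n) :=
  Group.ofLeftAxioms
    (fun a b c => by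
      refine ext' ?_ ?_
      · simp only [mul_fst, add_assoc]
      · simp only [mul_fst, mul_snd, herm_add_left, herm_add_right, Complex.add_im]
        ring)
    (fun a => by
      refine ext' ?_ ?_
      · simp [mul_fst, one_fst]
      · simp [mul_snd, one_fst, one_snd, herm])
    (fun a => by
      refine ext' ?_ ?_
      · simp [mul_fst, inv_fst, one_fst]
      · simp [mul_snd, inv_fst, inv_snd, one_snd, herm_neg_self_im])

lemma continuous_herm : Continuous fun p : (Fin n → ℂ) × (Fin n → ℂ) => herm p.1 p.2 := by
  unfold herm
  fun_prop

instance : ContinuousMul (Heisenberg n) where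
  continuous_mul := by
    have h1 : Continuous fun p : ((Fin n → ℂ) × ℝ) × ((Fin n → ℂ) × ℝ) => herm p.1.1 p.2.1 :=
      continuous_herm.comp (by fun_prop : Continuous
        fun p : ((Fin n → ℂ) × ℝ) × ((Fin n → ℂ) × ℝ) => (p.1.1, p.2.1))
    have : Continuous fun p : ((Fin n → ℂ) × ℝ) × ((Fin n → ℂ) × ℝ) =>
        (p.1.1 + p.2.1, p.1.2 + p.2.2 + (1 / 2 : ℝ) * (herm p.1.1 p.2.1).im) := by fun_prop
    exact this

instance : ContinuousInv (Heisenberg n) where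
  continuous_inv := by
    have : Continuous fun p : (Fin n → ℂ) × ℝ => (-p.1, -p.2) := by fun_prop
    exact this

instance : IsTopologicalGroup (Heisenberg n) where

instance : (volume : Measure (Heisenberg n)).IsMulRightInvariant where
  map_mul_right_eq_self h := by
    have hz : MeasurePreserving (fun z : Fin n → ℂ => z + h.1) volume volume :=
      measurePreserving_add_right volume h.1
    have hc : Continuous fun p : (Fin n → ℂ) × ℝ =>
        p.2 + (h.2 + (1 / 2 : ℝ) * (herm p.1 h.1).im) := by
      have h1 : Continuous fun p : (Fin n → ℂ) × ℝ => herm p.1 h.1 :=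
        continuous_herm.comp (by fun_prop : Continuous fun p : (Fin n → ℂ) × ℝ => (p.1, h.1))
      fun_prop
    have := hz.skew_product (μc := (volume : Measure ℝ)) (μd := (volume : Measure ℝ))
      (g := fun z t => t + (h.2 + (1 / 2 : ℝ) * (herm z h.1).im)) hc.measurable
      (Eventually.of_forall fun z => (measurePreserving_add_right volume _).map_eq)
    have hm := this.map_eq
    have e : (fun p : (Fin n → ℂ) × ℝ =>
        (p.1 + h.1, p.2 + (h.2 + (1 / 2 : ℝ) * (herm p.1 h.1).im))) =
        fun p : Heisenberg n => p * h := by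
      funext p
      refine Prod.ext rfl ?_
      exact (add_assoc _ _ _).symm
    rw [← e]
    exact hm

/-- Inversion preserves Lebesgue measure. -/
lemma measurePreserving_inv :
    MeasurePreserving (fun g : Heisenberg n => g⁻¹) volume volume := by
  have h1 : MeasurePreserving (fun z : Fin n → ℂ => -z) volume volume :=
    Measure.measurePreserving_neg volume
  have h2 : MeasurePreserving (fun t : ℝ => -t) volume volume :=
    Measure.measurePreserving_neg volume
  exact h1.prod h2

/-- `L¹(ℍⁿ)`. -/
abbrev L1 (n : ℕ) : Type := Lp ℂ 1 (volume : Measure (Heisenberg n))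

/-- The integrand of `(f * g)(h) = ∫ f (h k⁻¹) g k dk`, as a function of `(k, h)`, is integrable. -/
lemma integrable_conv_integrand (f g : L1 n) :
    Integrable (fun p : Heisenberg n × Heisenberg n => f (p.2 * p.1⁻¹) * g p.1)
      ((volume : Measure (Heisenberg n)).prod volume) := by
  have h := (L1.integrable_coeFn g).mul_prod (L1.integrable_coeFn f)
  have hm := measurePreserving_prod_div (volume : Measure (Heisenberg n))
    (volume : Measure (Heisenberg n))
  have := hm.integrable_comp_of_integrable h
  refine this.congr (Eventually.of_forall fun p => ?_)
  simp [div_eq_mul_inv, mul_comm]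

/-- Convolution: `(f * g)(h) = ∫ f (h k⁻¹) g k dk`. -/
def conv (f g : L1 n) : L1 n :=
  (integrable_conv_integrand f g).integral_prod_right.toL1
    (fun h : Heisenberg n => ∫ k : Heisenberg n, f (h * k⁻¹) * g k)

/-- The involution `f*(z, t) = conj (f (-z, -t))`, with `(-z, -t) = (z, t)⁻¹`. -/
def invol (f : L1 n) : L1 n :=
  Integrable.toL1 (fun h : Heisenberg n => conj (f h⁻¹))
    (LinearIsometryEquiv.integrable_comp_iff (Complex.conjLIE : ℂ ≃ₗᵢ[ℝ] ℂ)|>.2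
      (measurePreserving_inv.integrable_comp_of_integrable (L1.integrable_coeFn f)))

/-- Right translation: `(R_g f)(h) = f (h g)`. -/
def rtrans (g : Heisenberg n) (f : L1 n) : L1 n :=
  Integrable.toL1 (fun h : Heisenberg n => f (h * g))
    ((measurePreserving_mul_right volume g).integrable_comp_of_integrable (L1.integrable_coeFn f))

/-- `L²(ℝⁿ)` with Lebesgue measure. -/
abbrev L2 (n : ℕ) : Type := Lp ℂ 2 (volume : Measure (Fin n → ℝ))

/-- The bounded operators on `L²(ℝⁿ)`. -/
abbrev Op (n : ℕ) : Type := L2 n →L[ℂ] L2 n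

/-- `ℝ* = ℝ ∖ {0}`. -/
abbrev RStar : Type := {l : ℝ // l ≠ 0}

/-- Multiplication of `φ` by the unimodular function `e^{iθ}`. -/
lemma memLp_expMul (θ : C(Fin n → ℝ, ℝ)) (φ : L2 n) :
    MemLp (fun ξ => Complex.exp (Complex.I * θ ξ) * φ ξ) 2 volume := by
  refine (Lp.memLp φ).of_le (g := fun ξ => φ ξ) ?_ (Eventually.of_forall fun ξ => ?_)
  · exact (Continuous.aestronglyMeasurable (by fun_prop)).mul (Lp.aestronglyMeasurable φ)
  · simp [Complex.norm_exp]

/-- Multiplication by the unimodular function `e^{iθ}` on `L²(ℝⁿ)`. -/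
def expMul (θ : C(Fin n → ℝ, ℝ)) : L2 n →ₗᵢ[ℂ] L2 n where
  toFun φ := (memLp_expMul θ φ).toLp _
  map_add' φ ψ := by
    apply Lp.ext
    filter_upwards [(memLp_expMul θ (φ + ψ)).coeFn_toLp, (memLp_expMul θ φ).coeFn_toLp,
      (memLp_expMul θ ψ).coeFn_toLp, Lp.coeFn_add φ ψ,
      Lp.coeFn_add ((memLp_expMul θ φ).toLp _) ((memLp_expMul θ ψ).toLp _)] with ξ h1 h2 h3 h4 h5
    rw [h1, h5, Pi.add_apply, h2, h3, h4, Pi.add_apply, mul_add]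
  map_smul' c φ := by
    apply Lp.ext
    filter_upwards [(memLp_expMul θ (c • φ)).coeFn_toLp, (memLp_expMul θ φ).coeFn_toLp,
      Lp.coeFn_smul c φ, Lp.coeFn_smul c ((memLp_expMul θ φ).toLp _)] with ξ h1 h2 h3 h4
    rw [h1, RingHom.id_apply, h4, Pi.smul_apply, h2, h3, Pi.smul_apply, smul_eq_mul, smul_eq_mul]
    ring
  norm_map' φ := by
    change ‖(memLp_expMul θ φ).toLp _‖ = ‖φ‖
    rw [Lp.norm_toLp, Lp.norm_def]
    congr 1
    exact eLpNorm_congr_norm_ae (Eventually.of_forall fun ξ => by simp [Complex.norm_exp])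

lemma tendsto_expMul {X : Type*} {F : Filter X} [F.IsCountablyGenerated]
    {θ : X → C(Fin n → ℝ, ℝ)} {θ₀ : C(Fin n → ℝ, ℝ)}
    (h : ∀ ξ, Tendsto (fun x => θ x ξ) F (𝓝 (θ₀ ξ))) (φ : L2 n) :
    Tendsto (fun x => expMul (θ x) φ) F (𝓝 (expMul θ₀ φ)) := by
  change Tendsto (fun x => (memLp_expMul (θ x) φ).toLp _) F (𝓝 ((memLp_expMul θ₀ φ).toLp _))
  rw [Lp.tendsto_Lp_iff_tendsto_eLpNorm'']
  have key : Tendsto (fun x => ∫⁻ ξ, ‖Complex.exp (Complex.I * θ x ξ) * φ ξ -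
      Complex.exp (Complex.I * θ₀ ξ) * φ ξ‖ₑ ^ (2 : ℝ)) F (𝓝 0) := by
    have hint : ∫⁻ ξ, (2 * ‖φ ξ‖ₑ) ^ (2 : ℝ) ≠ ∞ := by
      have h0 := lintegral_rpow_enorm_lt_top_of_eLpNorm_lt_top (by simp) (by simp)
        (Lp.memLp φ).2
      simp only [ENNReal.mul_rpow_of_nonneg _ _ (by norm_num : (0 : ℝ) ≤ 2)]
      rw [lintegral_const_mul' _ _ (by simp)]
      exact ENNReal.mul_ne_top (by simp) (by simpa using h0.ne)
    have := tendsto_lintegral_filter_of_dominated_convergence' (μ := volume) (l := F)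
      (F := fun x ξ => ‖Complex.exp (Complex.I * θ x ξ) * φ ξ -
        Complex.exp (Complex.I * θ₀ ξ) * φ ξ‖ₑ ^ (2 : ℝ)) (f := fun _ => 0)
      (fun ξ => (2 * ‖φ ξ‖ₑ) ^ (2 : ℝ)) ?_ ?_ hint ?_
    · simpa using this
    · refine Eventually.of_forall fun x => ?_
      exact (((memLp_expMul (θ x) φ).1.sub (memLp_expMul θ₀ φ).1).enorm).pow_const _
    · refine Eventually.of_forall fun x => Eventually.of_forall fun ξ => ?_
      refine ENNReal.rpow_le_rpow ((enorm_sub_le).trans (le_of_eq ?_)) (by norm_num)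
      have e : ∀ r : ℝ, ‖Complex.exp (Complex.I * r)‖ₑ = 1 := fun r => by
        rw [← ofReal_norm]
        simp [Complex.norm_exp]
      rw [enorm_mul, enorm_mul, e, e, two_mul, one_mul]
    · refine Eventually.of_forall fun ξ => ?_
      have hc : Continuous fun r : ℝ => ‖Complex.exp (Complex.I * r) * φ ξ -
          Complex.exp (Complex.I * θ₀ ξ) * φ ξ‖ₑ ^ (2 : ℝ) :=
        ENNReal.continuous_rpow_const.comp (by fun_prop)
      simpa [Function.comp_def] using (hc.tendsto (θ₀ ξ)).comp (h ξ)
  have h2 := (ENNReal.continuous_rpow_const (y := (1 / 2 : ℝ))).tendsto 0 |>.comp key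
  rw [ENNReal.zero_rpow_of_pos (by norm_num)] at h2
  refine h2.congr fun x => ?_
  rw [eLpNorm_eq_lintegral_rpow_enorm_toReal (by simp) (by simp)]
  simp

/-- Translation `φ ↦ φ(· + y)` on `L²(ℝⁿ)`. -/
def shift (y : Fin n → ℝ) : L2 n →ₗᵢ[ℂ] L2 n :=
  Lp.compMeasurePreservingₗᵢ ℂ (fun ξ => ξ + y) (measurePreserving_add_right volume y)

/-- The phase `λ (t + x · ξ + ½ x · y)`, where `z = x + i y`. -/
def phase (l : ℝ) (g : Heisenberg n) : C(Fin n → ℝ, ℝ) where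
  toFun ξ := l * (g.2 + ∑ j, (g.1 j).re * ξ j + (1 / 2 : ℝ) * ∑ j, (g.1 j).re * (g.1 j).im)
  continuous_toFun := by fun_prop

/-- The Schrödinger representation
`(π_λ(z, t) φ)(ξ) = e^{iλt} e^{iλ(x · ξ + ½ x · y)} φ(ξ + y)`, where `z = x + i y`. -/
def rep (l : ℝ) (g : Heisenberg n) : Op n :=
  ((expMul (phase l g)).comp (shift fun j => (g.1 j).im)).toContinuousLinearMap

lemma rep_apply_ae (l : ℝ) (g : Heisenberg n) (φ : L2 n) :
    rep l g φ =ᵐ[volume] fun ξ =>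
      Complex.exp (Complex.I * l * g.2) *
        Complex.exp (Complex.I * l * (∑ j, ((g.1 j).re : ℂ) * ξ j +
          (1 / 2) * ∑ j, ((g.1 j).re : ℂ) * (g.1 j).im)) *
        φ (ξ + fun j => (g.1 j).im) := by
  have h1 := (memLp_expMul (phase l g) (shift (fun j => (g.1 j).im) φ)).coeFn_toLp
  have h2 : shift (fun j => (g.1 j).im) φ =ᵐ[volume] fun ξ => φ (ξ + fun j => (g.1 j).im) :=
    Lp.coeFn_compMeasurePreserving φ (measurePreserving_add_right volume fun j => (g.1 j).im)
  filter_upwards [h1, h2] with ξ h1 h2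
  change ((memLp_expMul (phase l g) (shift (fun j => (g.1 j).im) φ)).toLp _) ξ = _
  rw [h1, h2, ← Complex.exp_add]
  congr 2
  simp only [phase, ContinuousMap.coe_mk]
  push_cast
  ring

lemma norm_rep_apply (l : ℝ) (g : Heisenberg n) (φ : L2 n) : ‖rep l g φ‖ = ‖φ‖ :=
  LinearIsometry.norm_map _ _

lemma continuous_shift (φ : L2 n) : Continuous fun y : Fin n → ℝ => shift y φ := by
  have : Continuous fun y : Fin n → ℝ =>
      Lp.compMeasurePreserving (fun ξ : Fin n → ℝ => ξ + y)
        (measurePreserving_add_right volume y) φ := by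
    refine Continuous.compMeasurePreservingLp (f := fun _ => φ)
      (g := fun y : Fin n → ℝ => (⟨fun ξ => ξ + y, by fun_prop⟩ : C(Fin n → ℝ, Fin n → ℝ)))
      continuous_const ?_ (fun y => measurePreserving_add_right volume y) (by simp)
    exact ContinuousMap.continuous_of_continuous_uncurry _ (by
      simp only [Function.uncurry_def, ContinuousMap.coe_mk]; fun_prop)
  exact this

/-- Strong continuity of `h ↦ π_λ(h)`. -/
lemma continuous_rep_apply (l : ℝ) (φ : L2 n) :
    Continuous fun g : Heisenberg n => rep l g φ := by
  refine continuous_iff_continuousAt.2 fun g₀ => ?_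
  set ψ : L2 n := shift (fun j => (g₀.1 j).im) φ with hψ
  have hphase : ∀ ξ, Continuous fun g : Heisenberg n => phase l g ξ := fun ξ => by
    have : Continuous fun p : (Fin n → ℂ) × ℝ => l * (p.2 + ∑ j, (p.1 j).re * ξ j +
        (1 / 2 : ℝ) * ∑ j, (p.1 j).re * (p.1 j).im) := by fun_prop
    exact this
  have him : Continuous fun g : Heisenberg n => fun j => (g.1 j).im := by
    have : Continuous fun p : (Fin n → ℂ) × ℝ => fun j => (p.1 j).im := by fun_prop
    exact this
  have h1 : Tendsto (fun g : Heisenberg n => ‖shift (fun j => (g.1 j).im) φ - ψ‖) (𝓝 g₀) (𝓝 0) :=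
    tendsto_iff_norm_sub_tendsto_zero.1 (((continuous_shift φ).comp him).tendsto g₀)
  have h2 : Tendsto (fun g : Heisenberg n => expMul (phase l g) ψ) (𝓝 g₀)
      (𝓝 (expMul (phase l g₀) ψ)) :=
    tendsto_expMul (fun ξ => (hphase ξ).tendsto g₀) ψ
  rw [ContinuousAt, tendsto_iff_norm_sub_tendsto_zero]
  have h3 := h1.add (tendsto_iff_norm_sub_tendsto_zero.1 h2)
  rw [add_zero] at h3
  refine squeeze_zero (fun _ => norm_nonneg _) (fun g => ?_) h3
  have e : rep l g φ - rep l g₀ φ =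
      expMul (phase l g) (shift (fun j => (g.1 j).im) φ - ψ) +
        (expMul (phase l g) ψ - expMul (phase l g₀) ψ) := by
    rw [map_sub, sub_add_sub_cancel]
    rfl
  rw [e]
  refine (norm_add_le _ _).trans ?_
  rw [LinearIsometry.norm_map]

lemma integrable_smul_rep (l : ℝ) (f : L1 n) (φ : L2 n) :
    Integrable (fun h : Heisenberg n => f h • rep l h φ) := by
  refine ((L1.integrable_coeFn f).norm.mul_const ‖φ‖).mono'
    ((Lp.aestronglyMeasurable f).smul (continuous_rep_apply l φ).aestronglyMeasurable)
    (Eventually.of_forall fun h => ?_)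
  rw [norm_smul, norm_rep_apply]

/-- The group Fourier transform `f̂(λ) = ∫ f(z, t) π_λ(z, t) dz dt`, the integral of operators
being taken in the strong sense: `f̂(λ) φ = ∫ f(z, t) π_λ(z, t) φ dz dt` in `L²(ℝⁿ)`. -/
def fourier (f : L1 n) (l : ℝ) : Op n :=
  LinearMap.mkContinuous
    { toFun := fun φ => ∫ h : Heisenberg n, f h • rep l h φ
      map_add' := fun φ ψ => by
        simp only [map_add, smul_add]
        exact integral_add (integrable_smul_rep l f φ) (integrable_smul_rep l f ψ)
      map_smul' := fun c φ => by
        simp only [map_smul, RingHom.id_apply, smul_comm _ c]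
        exact integral_smul c _ }
    (∫ h : Heisenberg n, ‖f h‖)
    (fun φ => by
      refine (norm_integral_le_integral_norm _).trans (le_of_eq ?_)
      simp only [norm_smul, norm_rep_apply]
      exact integral_mul_const _ _)

/-- The measure `dμ(λ) = (2π)^{-n-1} |λ|ⁿ dλ` on `ℝ*`. -/
def planch (n : ℕ) : Measure RStar :=
  (Measure.comap ((↑) : RStar → ℝ) volume).withDensity fun l =>
    ENNReal.ofReal (((2 * Real.pi) ^ (n + 1))⁻¹ * |(l : ℝ)| ^ n)

/-- The functions `F : ℝ* → B(L²(ℝⁿ))` that are weakly measurable (all matrix coefficients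
`λ ↦ ⟪ψ, F(λ) φ⟫` are measurable) and essentially bounded. -/
def linftySubmodule (n : ℕ) : Submodule ℂ (RStar → Op n) where
  carrier := {F | (∀ φ ψ : L2 n, AEMeasurable (fun l => inner ℂ ψ (F l φ)) (planch n)) ∧
    ∃ C : ℝ, ∀ᵐ l ∂(planch n), ‖F l‖ ≤ C}
  zero_mem' := ⟨fun φ ψ => by simp, 0, by simp⟩
  add_mem' := by
    rintro F G ⟨hF, C, hC⟩ ⟨hG, D, hD⟩
    refine ⟨fun φ ψ => ?_, C + D, ?_⟩
    · simp only [Pi.add_apply, add_apply, inner_add_right]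
      exact (hF φ ψ).add (hG φ ψ)
    · filter_upwards [hC, hD] with l h1 h2
      exact (norm_add_le _ _).trans (add_le_add h1 h2)
  smul_mem' := by
    rintro c F ⟨hF, C, hC⟩
    refine ⟨fun φ ψ => ?_, ‖c‖ * C, ?_⟩
    · simp only [Pi.smul_apply, smul_apply, inner_smul_right]
      exact (hF φ ψ).const_mul c
    · filter_upwards [hC] with l h1
      rw [Pi.smul_apply, norm_smul]
      gcongr

/-- Essentially bounded weakly measurable functions `ℝ* → B(L²(ℝⁿ))`, before the
identification of functions that agree almost everywhere. -/
def PreLinfty (n : ℕ) : Type := linftySubmodule n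

instance : AddCommGroup (PreLinfty n) := inferInstanceAs (AddCommGroup (linftySubmodule n))

instance : Module ℂ (PreLinfty n) := inferInstanceAs (Module ℂ (linftySubmodule n))

/-- The underlying function. -/
def PreLinfty.toFun (F : PreLinfty n) : RStar → Op n := F.1

lemma PreLinfty.essSup_ne_top (F : PreLinfty n) : eLpNormEssSup F.toFun (planch n) ≠ ∞ := by
  obtain ⟨-, C, hC⟩ := F.2
  exact (eLpNormEssSup_lt_top_of_ae_bound hC).ne

/-- The essential supremum of `λ ↦ ‖F(λ)‖`. -/
instance : Norm (PreLinfty n) where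
  norm F := (eLpNormEssSup F.toFun (planch n)).toReal

lemma PreLinfty.norm_def (F : PreLinfty n) :
    ‖F‖ = (eLpNormEssSup F.toFun (planch n)).toReal := rfl

lemma PreLinfty.toFun_smul (c : ℂ) (F : PreLinfty n) : (c • F).toFun = c • F.toFun := rfl

lemma PreLinfty.toFun_add (F G : PreLinfty n) : (F + G).toFun = F.toFun + G.toFun := rfl

lemma PreLinfty.toFun_sub (F G : PreLinfty n) : (F - G).toFun = F.toFun - G.toFun := rfl

lemma essSup_smul (c : ℂ) (F : RStar → Op n) :
    eLpNormEssSup (c • F) (planch n) = ‖c‖ₑ * eLpNormEssSup F (planch n) := by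
  simp only [eLpNormEssSup_eq_essSup_enorm, Pi.smul_apply, enorm_smul]
  exact ENNReal.essSup_const_mul

lemma essSup_add_le (F G : RStar → Op n) :
    eLpNormEssSup (F + G) (planch n) ≤
      eLpNormEssSup F (planch n) + eLpNormEssSup G (planch n) := by
  refine eLpNormEssSup_le_of_ae_enorm_bound ?_
  filter_upwards [enorm_ae_le_eLpNormEssSup F (planch n),
    enorm_ae_le_eLpNormEssSup G (planch n)] with l h1 h2
  exact (enorm_add_le (F l) (G l)).trans (add_le_add h1 h2)

lemma preLinfty_core : SeminormedSpace.Core ℂ (PreLinfty n) where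
  norm_nonneg _ := ENNReal.toReal_nonneg
  norm_smul c F := by
    simp only [PreLinfty.norm_def]
    rw [PreLinfty.toFun_smul, essSup_smul, ENNReal.toReal_mul, toReal_enorm]
  norm_triangle F G := by
    simp only [PreLinfty.norm_def, PreLinfty.toFun_add]
    rw [← ENNReal.toReal_add F.essSup_ne_top G.essSup_ne_top]
    exact ENNReal.toReal_mono (ENNReal.add_ne_top.2 ⟨F.essSup_ne_top, G.essSup_ne_top⟩)
      (essSup_add_le F.toFun G.toFun)

instance : SeminormedAddCommGroup (PreLinfty n) := SeminormedAddCommGroup.ofCore preLinfty_core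

instance : NormedSpace ℂ (PreLinfty n) where
  norm_smul_le c F := (preLinfty_core.norm_smul c F).le

/-- `L^∞(ℝ*, B(L²(ℝⁿ)), dμ)`: essentially bounded weakly measurable functions modulo equality
almost everywhere, with the essential supremum norm. -/
abbrev Linfty (n : ℕ) : Type := SeparationQuotient (PreLinfty n)

/-- A representative of a class in `L^∞(ℝ*, B(L²(ℝⁿ)), dμ)`, as a function of `λ`. -/
instance : CoeFun (Linfty n) fun _ => RStar → Op n where
  coe u := (Quotient.out u : PreLinfty n).toFun

/-- Two functions represent the same class exactly when they agree almost everywhere. -/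
lemma mk_eq_mk_iff (F G : PreLinfty n) :
    (SeparationQuotient.mk F = SeparationQuotient.mk G) ↔ F.toFun =ᵐ[planch n] G.toFun := by
  rw [SeparationQuotient.mk_eq_mk, Metric.inseparable_iff, dist_eq_norm, PreLinfty.norm_def,
    ENNReal.toReal_eq_zero_iff, or_iff_left (F - G).essSup_ne_top, PreLinfty.toFun_sub]
  refine (eLpNormEssSup_eq_zero_iff (μ := planch n) (f := F.toFun - G.toFun)).trans ?_
  exact eventuallyEq_iff_sub.symm

lemma coeFn_mk (F : PreLinfty n) :
    (SeparationQuotient.mk F : Linfty n) =ᵐ[planch n] F.toFun := by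
  rw [← mk_eq_mk_iff]
  exact Quotient.out_eq _

/-- `A` is the essential support of the family `(T f)_f`: up to null sets, the smallest measurable
set off which all the functions `T f` vanish almost everywhere. -/
def IsEssSupport (T : L1 n → Linfty n) (A : Set RStar) : Prop :=
  MeasurableSet A ∧ (∀ f, ∀ᵐ l ∂(planch n), l ∉ A → T f l = 0) ∧
    ∀ B : Set RStar, MeasurableSet B → (∀ f, ∀ᵐ l ∂(planch n), l ∉ B → T f l = 0) →
      A ≤ᵐ[planch n] B

end Heisenberg

end

/-!
The heart of the matter is the irreducibility of the Schrödinger representation `π_λ`, `λ ≠ 0`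
(`eq_zero_of_forall_inner_rep_eq_zero`): a vector orthogonal to the orbit of a nonzero vector is
zero. The matrix coefficients of `π_λ` are Fourier transforms of the functions
`ξ ↦ conj (ψ ξ) φ(ξ + y)`, so this comes down to the injectivity of the Fourier transform on `L¹`.

Consider first a fixed `λ` and a homomorphism `S : L¹(ℍⁿ) → B(L²(ℝⁿ))` of involutive algebras with
`S (R_h f) = S f ∘ π_λ(h)*`. It is automatically contractive (`norm_le_of_invol_of_conv`). The
convolution is the vector-valued integral `f * g = ∫ g(k) R_{k⁻¹} f dk` (`conv_eq_integral`), and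
applying `S` to it gives `S f ∘ S g = S (f * g) = S f ∘ ĝ(λ)`. Hence `Y = S g - ĝ(λ)` is
annihilated on the left by every `S (R_h f) = S f ∘ π_λ(h)*`. If `S f ≠ 0`, the range of `Y` is
thus orthogonal to the `π_λ`-orbit of the nonzero range of `(S f)*`, and irreducibility gives
`Y = 0` (`eq_zero_of_comp_rep_comp_eq_zero`). This is part (b).

For part (a) the same identity `T (f * g) = T f ∘ ĝ` is proved almost everywhere, by testing against
the functionals `u ↦ ∫_B ⟪ψ, u(λ) φ⟫` on `L^∞` and using Fubini (`map_conv_ae_eq_comp_fourier`).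
Separability of `ℍⁿ`, `L²(ℝⁿ)` and `L¹(ℍⁿ)` reduces the exceptional sets to countably many, and
the essential support is the set where the image of some member of a dense sequence in `L¹(ℍⁿ)`
does not vanish.
-/

namespace Heisenberg

variable {n : ℕ}

/-! ### Irreducibility of the Schrödinger representation -/

/-- Injectivity of the Fourier transform on real functions in `L¹(ℝⁿ)`: the positive and the
negative part of `g` are the densities of two finite measures with the same characteristic
function. -/
lemma ae_eq_zero_of_integral_exp_mul_ofReal_eq_zero {g : (Fin n → ℝ) → ℝ} (hg : Integrable g)
    (h : ∀ x : Fin n → ℝ, ∫ ξ, Complex.exp (Complex.I * ∑ j, (x j : ℂ) * ξ j) * g ξ = 0) :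
    g =ᵐ[volume] 0 := by
  have hfin : ∀ u : (Fin n → ℝ) → ℝ, Integrable u →
      IsFiniteMeasure (volume.withDensity fun ξ => ENNReal.ofReal (u ξ)) := fun u hu =>
    isFiniteMeasure_withDensity_ofReal hu.2
  have hchar : ∀ u : (Fin n → ℝ) → ℝ, Integrable u → ∀ L : StrongDual ℝ (Fin n → ℝ),
      charFunDual (volume.withDensity fun ξ => ENNReal.ofReal (u ξ)) L =
        ∫ ξ, Complex.exp (L ξ * Complex.I) * (max (u ξ) 0 : ℝ) := by
    intro u hu L
    rw [charFunDual_apply, integral_withDensity_eq_integral_toReal_smul₀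
      hu.1.aemeasurable.ennreal_ofReal (Eventually.of_forall fun _ => ENNReal.ofReal_lt_top)]
    refine integral_congr_ae (Eventually.of_forall fun ξ => ?_)
    simp only [ENNReal.toReal_ofReal', Complex.real_smul]
    ring
  have hint : ∀ u : (Fin n → ℝ) → ℝ, Integrable u → ∀ L : StrongDual ℝ (Fin n → ℝ),
      Integrable fun ξ => Complex.exp (L ξ * Complex.I) * (max (u ξ) 0 : ℝ) := by
    intro u hu L
    refine hu.pos_part.ofReal.bdd_mul (c := 1) (Continuous.aestronglyMeasurable (by fun_prop)) ?_
    exact Eventually.of_forall fun ξ => by simp [Complex.norm_exp]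
  have := hfin g hg
  have := hfin (fun ξ => -g ξ) hg.neg
  have hμ : (volume.withDensity fun ξ => ENNReal.ofReal (g ξ)) =
      volume.withDensity fun ξ => ENNReal.ofReal (-g ξ) := by
    refine Measure.ext_of_charFunDual ?_
    ext L
    rw [hchar g hg, hchar (fun ξ => -g ξ) hg.neg, ← sub_eq_zero, ← integral_sub (hint g hg L)
      (hint (fun ξ => -g ξ) hg.neg L), ← h fun j => L (Pi.single j 1)]
    refine integral_congr_ae (Eventually.of_forall fun ξ => ?_)
    have hL : L ξ = ∑ j, L (Pi.single j 1) * ξ j := by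
      conv_lhs => rw [pi_eq_sum_univ' ξ]
      simp [map_sum, mul_comm]
    have hmax : max (g ξ) 0 - max (-g ξ) 0 = g ξ := max_zero_sub_max_neg_zero_eq_self _
    simp only
    rw [← mul_sub, ← Complex.ofReal_sub, hmax, hL]
    push_cast
    rw [mul_comm Complex.I]
  have hae := (withDensity_eq_iff hg.1.aemeasurable.ennreal_ofReal
    hg.neg.1.aemeasurable.ennreal_ofReal (by
      have := measure_ne_top (volume.withDensity fun ξ => ENNReal.ofReal (g ξ)) Set.univ
      rwa [withDensity_apply _ MeasurableSet.univ, Measure.restrict_univ] at this)).1 hμ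
  filter_upwards [hae] with ξ hξ
  have h1 := congrArg ENNReal.toReal hξ
  simp only [ENNReal.toReal_ofReal', Pi.neg_apply] at h1
  have := max_zero_sub_max_neg_zero_eq_self (g ξ)
  rw [h1, sub_self] at this
  exact this.symm

/-- Injectivity of the Fourier transform on `L¹(ℝⁿ)`. -/
lemma ae_eq_zero_of_integral_exp_mul_eq_zero {f : (Fin n → ℝ) → ℂ} (hf : Integrable f)
    (h : ∀ x : Fin n → ℝ, ∫ ξ, Complex.exp (Complex.I * ∑ j, (x j : ℂ) * ξ j) * f ξ = 0) :
    f =ᵐ[volume] 0 := by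
  have hint : ∀ (u : (Fin n → ℝ) → ℂ), Integrable u → ∀ x : Fin n → ℝ,
      Integrable fun ξ => Complex.exp (Complex.I * ∑ j, (x j : ℂ) * ξ j) * u ξ := by
    intro u hu x
    refine hu.bdd_mul (c := 1) (Continuous.aestronglyMeasurable (by fun_prop)) ?_
    refine Eventually.of_forall fun ξ => ?_
    simp [Complex.norm_exp]
  have hconj : Integrable fun ξ => conj (f ξ) :=
    (LinearIsometryEquiv.integrable_comp_iff (Complex.conjLIE : ℂ ≃ₗᵢ[ℝ] ℂ)).2 hf
  have h' : ∀ x : Fin n → ℝ,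
      ∫ ξ, Complex.exp (Complex.I * ∑ j, (x j : ℂ) * ξ j) * conj (f ξ) = 0 := by
    intro x
    have := congrArg conj (h (-x))
    rw [← integral_conj, map_zero] at this
    rw [← this]
    refine integral_congr_ae (Eventually.of_forall fun ξ => ?_)
    simp [← Complex.exp_conj]
  have hre : (fun ξ => (f ξ).re) =ᵐ[volume] 0 := by
    refine ae_eq_zero_of_integral_exp_mul_ofReal_eq_zero hf.re fun x => ?_
    have := congrArg (fun z => (1 / 2 : ℂ) * z)
      (integral_add (hint f hf x) (hint _ hconj x))
    simp only [h, h', add_zero, mul_zero] at this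
    rw [← integral_const_mul] at this
    rw [← this]
    refine integral_congr_ae (Eventually.of_forall fun ξ => ?_)
    simp only [Complex.re_eq_add_conj]
    ring
  have him : (fun ξ => (f ξ).im) =ᵐ[volume] 0 := by
    refine ae_eq_zero_of_integral_exp_mul_ofReal_eq_zero hf.im fun x => ?_
    have := congrArg (fun z => (1 / (2 * Complex.I) : ℂ) * z)
      (integral_sub (hint f hf x) (hint _ hconj x))
    simp only [h, h', sub_zero, mul_zero] at this
    rw [← integral_const_mul] at this
    rw [← this]
    refine integral_congr_ae (Eventually.of_forall fun ξ => ?_)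
    simp only [Complex.im_eq_sub_conj]
    ring
  filter_upwards [hre, him] with ξ h1 h2
  exact Complex.ext h1 h2

/-- Irreducibility of `π_λ`: a vector orthogonal to the orbit of a nonzero vector vanishes.
The matrix coefficient `⟪ψ, π_λ(x + iy, t) φ⟫` is, up to a unimodular factor, the Fourier
transform at `λx` of `ξ ↦ conj (ψ ξ) φ(ξ + y)`, which therefore vanishes for every `y`;
integrating its modulus over `y` gives `‖ψ‖₁ ‖φ‖₁ = 0`. -/
lemma eq_zero_of_forall_inner_rep_eq_zero {l : ℝ} (hl : l ≠ 0) {φ ψ : L2 n} (hφ : φ ≠ 0)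
    (h : ∀ g : Heisenberg n, inner ℂ ψ (rep l g φ) = 0) : ψ = 0 := by
  have hshift : ∀ y : Fin n → ℝ, MemLp (fun ξ => φ (ξ + y)) 2 volume := fun y =>
    (Lp.memLp φ).comp_measurePreserving (measurePreserving_add_right volume y)
  have hint : ∀ y : Fin n → ℝ, Integrable fun ξ => conj (ψ ξ) * φ (ξ + y) := by
    intro y
    have hc : MemLp (fun ξ => conj (ψ ξ)) 2 volume := (Lp.memLp ψ).star
    exact hc.integrable_mul (hshift y)
  have hzero : ∀ y : Fin n → ℝ, (fun ξ => conj (ψ ξ) * φ (ξ + y)) =ᵐ[volume] 0 := by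
    intro y
    refine ae_eq_zero_of_integral_exp_mul_eq_zero (hint y) fun x => ?_
    -- at this group element the phase is `x · ξ` up to a constant, whose exponential is `c`
    let g : Heisenberg n := (fun j => ⟨x j / l, y j⟩, 0)
    have hg := h g
    rw [L2.inner_def] at hg
    let c : ℂ := Complex.exp (Complex.I * l * (1 / 2 * ∑ j, ((x j / l : ℝ) : ℂ) * y j))
    have hc : c ≠ 0 := Complex.exp_ne_zero _
    refine (mul_eq_zero.1 (?_ : c * _ = 0)).resolve_left hc
    rw [← integral_const_mul, ← hg]
    refine integral_congr_ae ?_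
    filter_upwards [rep_apply_ae l g φ] with ξ hξ
    have e : Complex.exp (Complex.I * l * (∑ j, ((x j / l : ℝ) : ℂ) * ξ j +
          (1 / 2) * ∑ j, ((x j / l : ℝ) : ℂ) * y j)) =
        c * Complex.exp (Complex.I * ∑ j, (x j : ℂ) * ξ j) := by
      rw [← Complex.exp_add]
      congr 1
      rw [mul_add, add_comm]
      congr 1
      rw [mul_assoc, Finset.mul_sum]
      congr 1
      refine Finset.sum_congr rfl fun j _ => ?_
      have : (l : ℂ) ≠ 0 := by exact_mod_cast hl
      push_cast
      field_simp
    rw [hξ]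
    simp only [g, Complex.ofReal_zero, mul_zero, Complex.exp_zero, one_mul, e,
      RCLike.inner_apply]
    ring
  have hm : Measurable fun p : (Fin n → ℝ) × (Fin n → ℝ) => ‖ψ p.2‖ₑ * ‖φ (p.2 + p.1)‖ₑ :=
    ((Lp.stronglyMeasurable ψ).measurable.comp measurable_snd).enorm.mul
      ((Lp.stronglyMeasurable φ).measurable.comp (measurable_snd.add measurable_fst)).enorm
  have hprod : (∫⁻ ξ, ‖ψ ξ‖ₑ) * ∫⁻ ξ, ‖φ ξ‖ₑ = 0 := by
    calc (∫⁻ ξ, ‖ψ ξ‖ₑ) * ∫⁻ η, ‖φ η‖ₑ = ∫⁻ ξ, ∫⁻ y, ‖ψ ξ‖ₑ * ‖φ (ξ + y)‖ₑ := by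
          rw [← lintegral_mul_const _ (Lp.stronglyMeasurable ψ).measurable.enorm]
          refine lintegral_congr fun ξ => ?_
          have hφm : Measurable fun y => ‖φ (ξ + y)‖ₑ :=
            ((Lp.stronglyMeasurable φ).measurable.comp (measurable_const_add ξ)).enorm
          rw [lintegral_const_mul _ hφm, lintegral_add_left_eq_self (fun η => ‖φ η‖ₑ) ξ]
      _ = ∫⁻ y, ∫⁻ ξ, ‖ψ ξ‖ₑ * ‖φ (ξ + y)‖ₑ :=
          (lintegral_lintegral_swap hm.aemeasurable).symm
      _ = 0 := by
          rw [lintegral_eq_zero_of_ae_eq_zero]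
          refine Eventually.of_forall fun y => ?_
          change ∫⁻ ξ, ‖ψ ξ‖ₑ * ‖φ (ξ + y)‖ₑ = 0
          rw [lintegral_eq_zero_of_ae_eq_zero]
          filter_upwards [hzero y] with ξ hξ
          have := congrArg (fun z : ℂ => ‖z‖ₑ) hξ
          simpa [enorm_mul] using this
  have key : ∀ χ : L2 n, ∫⁻ ξ, ‖χ ξ‖ₑ = 0 → χ = 0 := by
    intro χ hχ
    rw [Lp.eq_zero_iff_ae_eq_zero]
    filter_upwards [(lintegral_eq_zero_iff (Lp.stronglyMeasurable χ).measurable.enorm).1 hχ]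
      with ξ hξ
    simpa using hξ
  rcases mul_eq_zero.1 hprod with h1 | h1
  · exact key ψ h1
  · exact absurd (key φ h1) hφ

lemma rep_rep_inv (l : ℝ) (g : Heisenberg n) (φ : L2 n) : rep l g (rep l g⁻¹ φ) = φ := by
  apply Lp.ext
  have h2 := (measurePreserving_add_right volume
    (fun j => (g.1 j).im)).quasiMeasurePreserving.ae (rep_apply_ae l g⁻¹ φ)
  filter_upwards [rep_apply_ae l g (rep l g⁻¹ φ), h2] with ξ h1 h2
  rw [h1, h2]
  have e : (ξ + fun j => (g.1 j).im) + (fun j => ((g⁻¹).1 j).im) = ξ := by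
    ext j
    simp [inv_fst]
  rw [e, ← mul_assoc, ← Complex.exp_add, ← Complex.exp_add, ← Complex.exp_add]
  convert one_mul (φ ξ) using 2
  rw [Complex.exp_eq_one_iff]
  refine ⟨0, ?_⟩
  have : ∑ j, ((g.1 j).re : ℂ) * ((ξ j + (g.1 j).im : ℝ) : ℂ) =
      ∑ j, ((g.1 j).re : ℂ) * ξ j + ∑ j, ((g.1 j).re : ℂ) * (g.1 j).im := by
    rw [← Finset.sum_add_distrib]
    refine Finset.sum_congr rfl fun j _ => ?_
    push_cast
    ring
  simp only [inv_fst, inv_snd, Pi.neg_apply, Pi.add_apply, Complex.neg_re, Complex.neg_im,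
    Complex.ofReal_neg, neg_mul, mul_neg, neg_neg, Finset.sum_neg_distrib, this]
  push_cast
  ring

lemma adjoint_rep (l : ℝ) (g : Heisenberg n) :
    ContinuousLinearMap.adjoint (rep l g) = rep l g⁻¹ := by
  refine ContinuousLinearMap.ext fun φ => ext_inner_left ℂ fun ψ => ?_
  rw [ContinuousLinearMap.adjoint_inner_right]
  conv_lhs => rw [← rep_rep_inv l g φ]
  exact LinearIsometry.inner_map_map ((expMul (phase l g)).comp (shift fun j => (g.1 j).im)) _ _

/-! ### The convolution algebra `L¹(ℍⁿ)` -/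

instance : LocallyCompactSpace (Heisenberg n) :=
  inferInstanceAs (LocallyCompactSpace ((Fin n → ℂ) × ℝ))

instance : T2Space (Heisenberg n) := inferInstanceAs (T2Space ((Fin n → ℂ) × ℝ))

instance : IsLocallyFiniteMeasure (volume : Measure (Heisenberg n)) :=
  inferInstanceAs (IsLocallyFiniteMeasure (volume : Measure ((Fin n → ℂ) × ℝ)))

instance : (volume : Measure (Heisenberg n)).InnerRegularCompactLTTop :=
  inferInstanceAs ((volume : Measure ((Fin n → ℂ) × ℝ)).InnerRegularCompactLTTop)

lemma coeFn_conv (f g : L1 n) :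
    conv f g =ᵐ[volume] fun h => ∫ k : Heisenberg n, f (h * k⁻¹) * g k :=
  Integrable.coeFn_toL1 _

lemma coeFn_invol (f : L1 n) : invol f =ᵐ[volume] fun h => conj (f h⁻¹) :=
  Integrable.coeFn_toL1 _

lemma coeFn_rtrans (g : Heisenberg n) (f : L1 n) : rtrans g f =ᵐ[volume] fun h => f (h * g) :=
  Integrable.coeFn_toL1 _

lemma rtrans_eq_compMeasurePreserving (g : Heisenberg n) (f : L1 n) :
    rtrans g f = Lp.compMeasurePreserving (fun h => h * g)
      (measurePreserving_mul_right volume g) f := by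
  apply Lp.ext
  exact (coeFn_rtrans g f).trans
    (Lp.coeFn_compMeasurePreserving f (measurePreserving_mul_right volume g)).symm

lemma norm_rtrans (g : Heisenberg n) (f : L1 n) : ‖rtrans g f‖ = ‖f‖ := by
  rw [rtrans_eq_compMeasurePreserving, Lp.norm_compMeasurePreserving]

lemma continuous_rtrans (f : L1 n) : Continuous fun g : Heisenberg n => rtrans g f := by
  simp only [rtrans_eq_compMeasurePreserving]
  refine Continuous.compMeasurePreservingLp (f := fun _ => f)
    (g := fun y : Heisenberg n => (⟨fun h => h * y, by fun_prop⟩ : C(Heisenberg n, Heisenberg n)))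
    continuous_const ?_ (fun y => measurePreserving_mul_right volume y) (by simp)
  exact ContinuousMap.continuous_of_continuous_uncurry _ (by
    simp only [Function.uncurry_def, ContinuousMap.coe_mk]; fun_prop)

lemma norm_invol (f : L1 n) : ‖invol f‖ = ‖f‖ := by
  rw [L1.norm_eq_integral_norm, L1.norm_eq_integral_norm,
    ← measurePreserving_inv.integral_comp (MeasurableEquiv.inv _).measurableEmbedding
      (fun h => ‖f h‖)]
  refine integral_congr_ae ?_
  filter_upwards [coeFn_invol f] with h hh
  rw [hh, RCLike.norm_conj]

lemma integrable_smul_rtrans (f g : L1 n) :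
    Integrable fun k : Heisenberg n => g k • rtrans k⁻¹ f := by
  refine ((L1.integrable_coeFn g).norm.mul_const ‖f‖).mono'
    ((Lp.aestronglyMeasurable g).smul
      ((continuous_rtrans f).comp continuous_inv).aestronglyMeasurable)
    (Eventually.of_forall fun h => ?_)
  rw [norm_smul, norm_rtrans]

/-- Convolution as a vector-valued integral of right translates. -/
lemma conv_eq_integral (f g : L1 n) : conv f g = ∫ k : Heisenberg n, g k • rtrans k⁻¹ f := by
  apply Lp.ext
  refine Integrable.ae_eq_of_forall_setIntegral_eq _ _ (L1.integrable_coeFn _)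
    (L1.integrable_coeFn _) fun s hs _ => ?_
  have hint := integrable_conv_integrand f g
  rw [setIntegral_congr_ae hs ((coeFn_conv f g).mono fun _ h _ => h)]
  have hswap : ∫ h in s, ∫ k : Heisenberg n, f (h * k⁻¹) * g k =
      ∫ k : Heisenberg n, ∫ h in s, f (h * k⁻¹) * g k := by
    refine integral_integral_swap (f := fun h k : Heisenberg n => f (h * k⁻¹) * g k) ?_
    have := hint.swap.restrict (s := s ×ˢ Set.univ)
    rw [← Measure.prod_restrict, Measure.restrict_univ] at this
    exact this
  let L : L1 n →L[ℂ] ℂ :=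
    { toFun := fun u => ∫ h in s, u h
      map_add' := fun u v => by
        rw [← integral_add (L1.integrable_coeFn u).integrableOn (L1.integrable_coeFn v).integrableOn]
        exact integral_congr_ae (ae_restrict_of_ae (Lp.coeFn_add u v))
      map_smul' := fun c u => by
        rw [RingHom.id_apply, ← integral_smul]
        exact integral_congr_ae (ae_restrict_of_ae (Lp.coeFn_smul c u))
      cont := continuous_setIntegral s }
  have hL : ∀ u : L1 n, ∫ h in s, u h = L u := fun _ => rfl
  rw [hswap, hL, ← ContinuousLinearMap.integral_comp_comm _ (integrable_smul_rtrans f g)]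
  refine integral_congr_ae (Eventually.of_forall fun k => ?_)
  simp only
  rw [map_smul, ← hL, setIntegral_congr_ae hs ((coeFn_rtrans k⁻¹ f).mono fun _ h _ => h),
    integral_mul_const, smul_eq_mul, mul_comm]

lemma norm_conv_le (f g : L1 n) : ‖conv f g‖ ≤ ‖f‖ * ‖g‖ := by
  rw [conv_eq_integral]
  refine (norm_integral_le_integral_norm _).trans (le_of_eq ?_)
  simp only [norm_smul, norm_rtrans]
  rw [integral_mul_const, ← L1.norm_eq_integral_norm, mul_comm]

lemma conv_sub_left (f f' g : L1 n) : conv (f - f') g = conv f g - conv f' g := by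
  simp only [conv_eq_integral]
  rw [← integral_sub (integrable_smul_rtrans f g) (integrable_smul_rtrans f' g)]
  refine integral_congr_ae (Eventually.of_forall fun k => ?_)
  simp only [rtrans_eq_compMeasurePreserving, map_sub, smul_sub]

/-- A continuous functional on `L¹(ℍⁿ)` can be applied to a convolution under the integral. -/
lemma map_conv (L : L1 n →L[ℂ] ℂ) (f g : L1 n) :
    L (conv f g) = ∫ k : Heisenberg n, g k * L (rtrans k⁻¹ f) := by
  rw [conv_eq_integral, ← ContinuousLinearMap.integral_comp_comm _ (integrable_smul_rtrans f g)]
  simp only [map_smul, smul_eq_mul]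

lemma inner_fourier (f : L1 n) (l : ℝ) (φ ψ : L2 n) :
    inner ℂ ψ (fourier f l φ) = ∫ k : Heisenberg n, f k * inner ℂ ψ (rep l k φ) := by
  change inner ℂ ψ (∫ h : Heisenberg n, f h • rep l h φ) = _
  rw [← integral_inner (integrable_smul_rep l f φ)]
  simp only [inner_smul_right]

lemma inner_comp_fourier (X : Op n) (f : L1 n) (l : ℝ) (φ ψ : L2 n) :
    inner ℂ ψ (X (fourier f l φ)) = ∫ k : Heisenberg n, f k * inner ℂ ψ (X (rep l k φ)) := by
  rw [← ContinuousLinearMap.adjoint_inner_left, inner_fourier]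
  simp only [ContinuousLinearMap.adjoint_inner_left]

/-! ### Automatic continuity and the identity for each `λ` -/

/-- If `‖g‖ < 1`, then `g` has a left quasi-inverse: a solution of `k = k * g - g`, so that
`1 - k` is formally inverse to `1 - g`. It is the fixed point of a contraction. -/
lemma exists_eq_conv_sub {g : L1 n} (hg : ‖g‖ < 1) : ∃ k : L1 n, conv k g - g = k := by
  have hc : ContractingWith ‖g‖₊ fun k : L1 n => conv k g - g := by
    refine ⟨by exact_mod_cast hg, LipschitzWith.of_dist_le_mul fun k k' => ?_⟩
    rw [dist_eq_norm, dist_eq_norm, sub_sub_sub_cancel_right, ← conv_sub_left, mul_comm]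
    exact norm_conv_le _ _
  obtain ⟨k, hk, -⟩ := hc.exists_fixedPoint 0 (edist_ne_top _ _)
  exact ⟨k, hk⟩

/-- Spectral values `z` of `S g` satisfy `‖z‖ ≤ ‖g‖`, because otherwise a quasi-inverse of
`z⁻¹ g` yields an inverse of `z - S g`; and the norm of a self-adjoint operator is its
spectral radius. -/
lemma norm_le_of_isSelfAdjoint (S : L1 n →ₗ[ℂ] Op n)
    (hconv : ∀ f g, S (conv f g) = (S f).comp (S g)) (g : L1 n) (hg : IsSelfAdjoint (S g)) :
    ‖S g‖ ≤ ‖g‖ := by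
  have key : ∀ z ∈ spectrum ℂ (S g), ‖z‖ ≤ ‖g‖ := by
    intro z hz
    by_contra! hlt
    have hz0 : z ≠ 0 := norm_pos_iff.1 ((norm_nonneg g).trans_lt hlt)
    have hzre : conj z = z := Complex.conj_eq_iff_real.2 ⟨z.re, hg.mem_spectrum_eq_re hz⟩
    obtain ⟨k, hk⟩ := exists_eq_conv_sub (g := z⁻¹ • g) (by
      rw [norm_smul, norm_inv, inv_mul_lt_iff₀ (norm_pos_iff.2 hz0), mul_one]
      exact hlt)
    set b : Op n := z⁻¹ • S g with hb
    have hbs : star b = b := by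
      rw [hb, star_smul, hg.star_eq, star_inv₀]
      congr 2
    have hSk : S k * b - b = S k := by
      have := congrArg S hk
      rw [map_sub, hconv, map_smul] at this
      exact this
    have hleft : (1 - S k) * (1 - b) = 1 := by
      rw [sub_mul, mul_sub, mul_sub, one_mul, one_mul, mul_one]
      nth_rewrite 1 [← hSk]
      abel
    -- `z` is real, so `1 - b` is self-adjoint and its left inverse yields a right inverse
    have hright : (1 - b) * star (1 - S k) = 1 := by
      have := congrArg star hleft
      rwa [star_mul, star_sub 1 b, hbs, star_one] at this
    have hu : IsUnit (1 - b) := isUnit_iff_exists_and_exists.2 ⟨⟨_, hright⟩, ⟨_, hleft⟩⟩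
    refine hz ?_
    have : algebraMap ℂ (Op n) z - S g = algebraMap ℂ (Op n) z * (1 - b) := by
      rw [mul_sub, mul_one, ← Algebra.smul_def, hb, smul_smul, mul_inv_cancel₀ hz0, one_smul]
    rw [spectrum.mem_resolventSet_iff, this]
    exact (hz0.isUnit.map _).mul hu
  have hr := hg.spectralRadius_eq_nnnorm
  have hle : spectralRadius ℂ (S g) ≤ ‖g‖₊ := iSup₂_le fun z hz => by
    exact_mod_cast key z hz
  rw [hr] at hle
  exact_mod_cast hle

/-- A homomorphism of involutive algebras from `L¹(ℍⁿ)` to `B(L²(ℝⁿ))` is contractive, by the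
`C*`-identity `‖S f‖² = ‖S (f* * f)‖`. -/
lemma norm_le_of_invol_of_conv (S : L1 n →ₗ[ℂ] Op n)
    (hadj : ∀ f, S (invol f) = ContinuousLinearMap.adjoint (S f))
    (hconv : ∀ f g, S (conv f g) = (S f).comp (S g)) (f : L1 n) : ‖S f‖ ≤ ‖f‖ := by
  have hS : S (conv (invol f) f) = (ContinuousLinearMap.adjoint (S f)).comp (S f) := by
    rw [hconv, hadj]
  have hsa : IsSelfAdjoint ((ContinuousLinearMap.adjoint (S f)).comp (S f)) := by
    rw [ContinuousLinearMap.isSelfAdjoint_iff', ContinuousLinearMap.adjoint_comp,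
      ContinuousLinearMap.adjoint_adjoint]
  have h1 := norm_le_of_isSelfAdjoint S hconv (conv (invol f) f) (hS ▸ hsa)
  rw [hS, ContinuousLinearMap.norm_adjoint_comp_self] at h1
  have h2 := h1.trans (norm_conv_le _ _)
  rw [norm_invol] at h2
  exact (mul_self_le_mul_self_iff (norm_nonneg _) (norm_nonneg _)).2 h2

/-- By irreducibility, an operator `Y` whose range, translated by `π_λ`, is annihilated by some
`X ≠ 0` vanishes: the range of `Y` is orthogonal to the orbit of the range of `X*`. -/
lemma eq_zero_of_comp_rep_comp_eq_zero {l : ℝ} (hl : l ≠ 0) {X Y : Op n} (hX : X ≠ 0)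
    (h : ∀ (g : Heisenberg n) (v : L2 n), X (ContinuousLinearMap.adjoint (rep l g) (Y v)) = 0) :
    Y = 0 := by
  have hX' : ContinuousLinearMap.adjoint X ≠ 0 := by
    rwa [ne_eq, LinearIsometryEquiv.map_eq_zero_iff]
  obtain ⟨χ, hχ⟩ : ∃ χ, ContinuousLinearMap.adjoint X χ ≠ 0 := by
    by_contra! h0
    exact hX' (ContinuousLinearMap.ext h0)
  refine ContinuousLinearMap.ext fun v => ?_
  refine eq_zero_of_forall_inner_rep_eq_zero hl hχ fun g => ?_
  rw [← ContinuousLinearMap.adjoint_inner_left, ContinuousLinearMap.adjoint_inner_right, h,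
    inner_zero_left]

/-- The identity `S (f * g) = S f ∘ ĝ(λ)`, obtained by applying `S` under the integral
`f * g = ∫ g(k) R_{k⁻¹} f dk`. -/
lemma map_conv_eq_comp_fourier {l : ℝ} (S : L1 n →L[ℂ] Op n)
    (htrans : ∀ (h : Heisenberg n) f,
      S (rtrans h f) = (S f).comp (ContinuousLinearMap.adjoint (rep l h))) (f g : L1 n) :
    S (conv f g) = (S f).comp (fourier g l) := by
  refine ContinuousLinearMap.ext fun φ => ext_inner_left ℂ fun ψ => ?_
  have := map_conv (((innerSL ℂ ψ).comp (ContinuousLinearMap.apply ℂ (L2 n) φ)).comp S) f g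
  simp only [ContinuousLinearMap.comp_apply, ContinuousLinearMap.apply_apply,
    innerSL_apply_apply, htrans, adjoint_rep, inv_inv] at this
  rw [this, ContinuousLinearMap.comp_apply, inner_comp_fourier]

/-- A nonzero homomorphism `S : L¹(ℍⁿ) → B(L²(ℝⁿ))` of involutive algebras that intertwines right
translation with `π_λ` is the Fourier transform at `λ`. -/
lemma eq_fourier_of_hom {l : ℝ} (hl : l ≠ 0) (S : L1 n →ₗ[ℂ] Op n)
    (hadj : ∀ f, S (invol f) = ContinuousLinearMap.adjoint (S f))
    (hconv : ∀ f g, S (conv f g) = (S f).comp (S g))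
    (htrans : ∀ (h : Heisenberg n) f,
      S (rtrans h f) = (S f).comp (ContinuousLinearMap.adjoint (rep l h)))
    {f₀ : L1 n} (hf₀ : S f₀ ≠ 0) (g : L1 n) : S g = fourier g l := by
  let S' : L1 n →L[ℂ] Op n := S.mkContinuous 1 fun f => by
    rw [one_mul]
    exact norm_le_of_invol_of_conv S hadj hconv f
  refine sub_eq_zero.1 (eq_zero_of_comp_rep_comp_eq_zero hl hf₀ fun h v => ?_)
  have h1 : (S (rtrans h f₀)).comp (S g) = (S (rtrans h f₀)).comp (fourier g l) := by
    rw [← hconv]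
    exact map_conv_eq_comp_fourier S' htrans (rtrans h f₀) g
  have h2 := DFunLike.congr_fun h1 v
  rw [htrans] at h2
  simp only [ContinuousLinearMap.comp_apply] at h2
  rw [sub_apply, map_sub, map_sub, h2, sub_self]

/-! ### Measurability in `λ` -/

instance : SFinite (planch n) := by
  have : LocallyCompactSpace RStar := (isOpen_ne (x := (0 : ℝ))).locallyCompactSpace
  have : IsFiniteMeasureOnCompacts (Measure.comap ((↑) : RStar → ℝ) volume) :=
    .comap' _ continuous_subtype_val
      (.subtype_coe (measurableSet_singleton (0 : ℝ)).compl)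
  unfold planch
  infer_instance

instance : TopologicalSpace.SeparableSpace (L1 n) := by
  have : Fact ((1 : ℝ≥0∞) ≠ ∞) := ⟨by simp⟩
  infer_instance

instance : TopologicalSpace.SeparableSpace (L2 n) := by
  have : Fact ((2 : ℝ≥0∞) ≠ ∞) := ⟨by simp⟩
  infer_instance

/-- Joint strong continuity of `(λ, h) ↦ π_λ(h)`. -/
lemma continuous_rep_uncurry_apply (φ : L2 n) :
    Continuous fun p : ℝ × Heisenberg n => rep p.1 p.2 φ := by
  refine continuous_iff_continuousAt.2 fun p₀ => ?_
  set ψ : L2 n := shift (fun j => (p₀.2.1 j).im) φ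
  have hphase : ∀ ξ, Continuous fun p : ℝ × Heisenberg n => phase p.1 p.2 ξ := fun ξ => by
    have : Continuous fun p : ℝ × ((Fin n → ℂ) × ℝ) => p.1 * (p.2.2 + ∑ j, (p.2.1 j).re * ξ j +
        (1 / 2 : ℝ) * ∑ j, (p.2.1 j).re * (p.2.1 j).im) := by fun_prop
    exact this
  have him : Continuous fun p : ℝ × Heisenberg n => fun j => (p.2.1 j).im := by
    have : Continuous fun p : ℝ × ((Fin n → ℂ) × ℝ) => fun j => (p.2.1 j).im := by fun_prop
    exact this
  have h1 : Tendsto (fun p : ℝ × Heisenberg n => ‖shift (fun j => (p.2.1 j).im) φ - ψ‖)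
      (𝓝 p₀) (𝓝 0) :=
    tendsto_iff_norm_sub_tendsto_zero.1 (((continuous_shift φ).comp him).tendsto p₀)
  have h2 : Tendsto (fun p : ℝ × Heisenberg n => expMul (phase p.1 p.2) ψ) (𝓝 p₀)
      (𝓝 (expMul (phase p₀.1 p₀.2) ψ)) :=
    tendsto_expMul (fun ξ => (hphase ξ).tendsto p₀) ψ
  rw [ContinuousAt, tendsto_iff_norm_sub_tendsto_zero]
  have h3 := h1.add (tendsto_iff_norm_sub_tendsto_zero.1 h2)
  rw [add_zero] at h3
  refine squeeze_zero (fun _ => norm_nonneg _) (fun p => ?_) h3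
  have e : rep p.1 p.2 φ - rep p₀.1 p₀.2 φ =
      expMul (phase p.1 p.2) (shift (fun j => (p.2.1 j).im) φ - ψ) +
        (expMul (phase p.1 p.2) ψ - expMul (phase p₀.1 p₀.2) ψ) := by
    rw [map_sub, sub_add_sub_cancel]
    rfl
  rw [e]
  refine (norm_add_le _ _).trans ?_
  rw [LinearIsometry.norm_map]

/-- A weakly measurable operator-valued function applied to a strongly measurable vector-valued
function is weakly measurable; one approximates the latter by simple functions. -/
lemma aemeasurable_inner_apply {X : Type*} [MeasurableSpace X] {m : Measure X} {F : X → Op n}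
    (hF : ∀ φ ψ : L2 n, AEMeasurable (fun x => inner ℂ ψ (F x φ)) m) {u : X → L2 n}
    (hu : StronglyMeasurable u) (ψ : L2 n) :
    AEMeasurable (fun x => inner ℂ ψ (F x (u x))) m := by
  have hs : ∀ s : SimpleFunc X (L2 n), AEMeasurable (fun x => inner ℂ ψ (F x (s x))) m := by
    intro s
    induction s using SimpleFunc.induction with
    | const c hS =>
      rename_i S
      refine ((hF c ψ).indicator hS).congr (Eventually.of_forall fun x => ?_)
      by_cases hx : x ∈ S <;> simp [hx]
    | add _ hf hg =>
      simp only [SimpleFunc.coe_add, Pi.add_apply, map_add, inner_add_right]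
      exact hf.add hg
  refine aemeasurable_of_tendsto_metrizable_ae atTop (fun k => hs (hu.approx k))
    (Eventually.of_forall fun x => ?_)
  have hc : Continuous fun v : L2 n => inner ℂ ψ (F x v) := by fun_prop
  exact (hc.tendsto _).comp (hu.tendsto_approx x)

/-! ### Representatives of classes in `L^∞` -/

lemma mk_out (u : Linfty n) :
    (SeparationQuotient.mk (Quotient.out u : PreLinfty n) : Linfty n) = u :=
  Quotient.out_eq u

lemma Linfty.coeFn_add (u v : Linfty n) :
    ∀ᵐ l ∂(planch n), (u + v : Linfty n) l = u l + v l := by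
  have h := coeFn_mk (Quotient.out u + Quotient.out v : PreLinfty n)
  rw [SeparationQuotient.mk_add, mk_out, mk_out] at h
  exact h

lemma Linfty.coeFn_sub (u v : Linfty n) :
    ∀ᵐ l ∂(planch n), (u - v : Linfty n) l = u l - v l := by
  have h := coeFn_mk (Quotient.out u - Quotient.out v : PreLinfty n)
  rw [SeparationQuotient.mk_sub, mk_out, mk_out] at h
  exact h

lemma Linfty.coeFn_smul (c : ℂ) (u : Linfty n) :
    ∀ᵐ l ∂(planch n), (c • u : Linfty n) l = c • u l := by
  have h := coeFn_mk (c • Quotient.out u : PreLinfty n)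
  rw [SeparationQuotient.mk_smul, mk_out] at h
  exact h

lemma Linfty.ae_norm_le (u : Linfty n) : ∀ᵐ l ∂(planch n), ‖u l‖ ≤ ‖u‖ := by
  have hn : ‖u‖ = (eLpNormEssSup (Quotient.out u : PreLinfty n).toFun (planch n)).toReal := by
    conv_lhs => rw [← mk_out u]
    rw [SeparationQuotient.norm_mk, PreLinfty.norm_def]
  filter_upwards [enorm_ae_le_eLpNormEssSup (Quotient.out u : PreLinfty n).toFun (planch n)]
    with l hl
  have := ENNReal.toReal_mono (Quotient.out u : PreLinfty n).essSup_ne_top hl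
  rwa [toReal_enorm, ← hn] at this

lemma Linfty.aemeasurable_inner (u : Linfty n) (φ ψ : L2 n) :
    AEMeasurable (fun l => inner ℂ ψ (u l φ)) (planch n) :=
  (Quotient.out u : PreLinfty n).2.1 φ ψ

lemma ext_of_inner_denseSeq {F G : Op n}
    (h : ∀ i j : ℕ, inner ℂ (TopologicalSpace.denseSeq (L2 n) i)
      (F (TopologicalSpace.denseSeq (L2 n) j)) = inner ℂ (TopologicalSpace.denseSeq (L2 n) i)
      (G (TopologicalSpace.denseSeq (L2 n) j))) : F = G := by
  have hd := TopologicalSpace.denseRange_denseSeq (L2 n)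
  refine DFunLike.coe_injective (hd.equalizer F.continuous G.continuous (funext fun j => ?_))
  refine ext_inner_left ℂ fun ψ => ?_
  refine hd.induction_on (p := fun ψ => inner ℂ ψ (F _) = inner ℂ ψ (G _)) ψ ?_ fun i => h i j
  exact isClosed_eq (by fun_prop) (by fun_prop)

lemma nullMeasurableSet_ne_zero (u : Linfty n) :
    NullMeasurableSet {l | u l ≠ 0} (planch n) := by
  have e : {l | u l ≠ 0} = ⋃ i : ℕ, ⋃ j : ℕ, (fun l => inner ℂ (TopologicalSpace.denseSeq (L2 n) i)
      (u l (TopologicalSpace.denseSeq (L2 n) j))) ⁻¹' {0}ᶜ := by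
    ext l
    simp only [Set.mem_ofPred_eq, Set.mem_iUnion, Set.mem_preimage, Set.mem_compl_iff,
      Set.mem_singleton_iff]
    rw [← not_iff_not]
    push Not
    refine ⟨fun h i j => by simp [h], fun h => ext_of_inner_denseSeq fun i j => by simp [h i j]⟩
  rw [e]
  refine .iUnion fun i => .iUnion fun j => ?_
  exact (u.aemeasurable_inner _ _).nullMeasurable (measurableSet_singleton 0).compl

/-! ### The identity almost everywhere -/

lemma Linfty.integrable_inner (u : Linfty n) (φ ψ : L2 n) :
    Integrable (fun l => inner ℂ ψ (u l φ)) (planch n).toFinite := by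
  refine Integrable.of_bound (C := ‖ψ‖ * (‖u‖ * ‖φ‖))
    ((u.aemeasurable_inner φ ψ).mono_ac
      (toFinite_absolutelyContinuous _)).aestronglyMeasurable ?_
  rw [ae_toFinite]
  filter_upwards [u.ae_norm_le] with l hl
  refine (norm_inner_le_norm _ _).trans ?_
  gcongr
  exact (u l).le_of_opNorm_le hl φ

/-- The functional `u ↦ ∫_B ⟪ψ, u(λ) φ⟫` on `L^∞`, the integral being taken with respect to a
finite measure with the same null sets as `μ`. -/
noncomputable def Linfty.setIntegralInner (B : Set RStar) (φ ψ : L2 n) : Linfty n →L[ℂ] ℂ :=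
  LinearMap.mkContinuous
    { toFun := fun u => ∫ l in B, inner ℂ ψ (u l φ) ∂(planch n).toFinite
      map_add' := fun u v => by
        rw [← integral_add (u.integrable_inner φ ψ).integrableOn
          (v.integrable_inner φ ψ).integrableOn]
        refine integral_congr_ae (ae_restrict_of_ae ?_)
        rw [ae_toFinite]
        filter_upwards [Linfty.coeFn_add u v] with l hl
        rw [hl, add_apply, inner_add_right]
      map_smul' := fun c u => by
        rw [RingHom.id_apply, ← integral_smul]
        refine integral_congr_ae (ae_restrict_of_ae ?_)
        rw [ae_toFinite]
        filter_upwards [Linfty.coeFn_smul c u] with l hl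
        rw [hl, smul_apply, inner_smul_right, smul_eq_mul] }
    (‖ψ‖ * ‖φ‖ * ((planch n).toFinite.real B))
    (fun u => by
      refine (norm_setIntegral_le_of_norm_le_const_ae (C := ‖ψ‖ * (‖u‖ * ‖φ‖))
        (measure_lt_top _ _) ?_).trans (le_of_eq (by ring))
      refine ae_restrict_of_ae ?_
      rw [ae_toFinite]
      filter_upwards [u.ae_norm_le] with l hl
      refine (norm_inner_le_norm _ _).trans ?_
      gcongr
      exact (u l).le_of_opNorm_le hl φ)

lemma Linfty.setIntegralInner_apply (B : Set RStar) (φ ψ : L2 n) (u : Linfty n) :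
    Linfty.setIntegralInner B φ ψ u = ∫ l in B, inner ℂ ψ (u l φ) ∂(planch n).toFinite := rfl

lemma Linfty.integrable_mul_inner_rep (u : Linfty n) (g : L1 n) (φ ψ : L2 n) :
    Integrable (fun p : RStar × Heisenberg n => g p.2 * inner ℂ ψ (u p.1 (rep (p.1 : ℝ) p.2 φ)))
      ((planch n).toFinite.prod volume) := by
  have hrep : StronglyMeasurable fun p : RStar × Heisenberg n => rep (p.1 : ℝ) p.2 φ :=
    ((continuous_rep_uncurry_apply φ).comp
      ((continuous_subtype_val.comp continuous_fst).prodMk continuous_snd)).stronglyMeasurable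
  have hm : AEMeasurable (fun p : RStar × Heisenberg n =>
      inner ℂ ψ (u p.1 (rep (p.1 : ℝ) p.2 φ))) ((planch n).toFinite.prod volume) := by
    refine aemeasurable_inner_apply (F := fun p : RStar × Heisenberg n => u p.1)
      (fun φ ψ => ?_) hrep ψ
    exact ((u.aemeasurable_inner φ ψ).mono_ac (toFinite_absolutelyContinuous _)).comp_fst
  have hg : Integrable (fun p : RStar × Heisenberg n => g p.2)
      ((planch n).toFinite.prod volume) := (L1.integrable_coeFn g).comp_snd _
  refine hg.mul_bdd (c := ‖ψ‖ * (‖u‖ * ‖φ‖)) hm.aestronglyMeasurable ?_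
  have hu : ∀ᵐ l ∂(planch n).toFinite, ‖u l‖ ≤ ‖u‖ := by
    rw [ae_toFinite]
    exact u.ae_norm_le
  filter_upwards [Measure.quasiMeasurePreserving_fst.ae hu] with p hp
  refine (norm_inner_le_norm _ _).trans ?_
  gcongr
  refine ((u p.1).le_of_opNorm_le hp _).trans (le_of_eq ?_)
  rw [norm_rep_apply]

/-- The identity `T (f * g) = T f ∘ ĝ` almost everywhere. It is tested against the functionals
`u ↦ ∫_B ⟪ψ, u(λ) φ⟫`, for which it follows from `f * g = ∫ g(k) R_{k⁻¹} f dk` and Fubini. -/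
lemma map_conv_ae_eq_comp_fourier (T : L1 n →L[ℂ] Linfty n)
    (h_trans : ∀ (h : Heisenberg n) (f : L1 n), ∀ᵐ l ∂(planch n),
      T (rtrans h f) l = (T f l).comp (ContinuousLinearMap.adjoint (rep (l : ℝ) h)))
    (f g : L1 n) :
    ∀ᵐ l ∂(planch n), T (conv f g) l = (T f l).comp (fourier g (l : ℝ)) := by
  have key : ∀ φ ψ : L2 n, ∀ᵐ l ∂(planch n),
      inner ℂ ψ (T (conv f g) l φ) = inner ℂ ψ ((T f l).comp (fourier g (l : ℝ)) φ) := by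
    intro φ ψ
    have hint := (T f).integrable_mul_inner_rep g φ ψ
    rw [← ae_toFinite]
    refine Integrable.ae_eq_of_forall_setIntegral_eq _ _ ((T (conv f g)).integrable_inner φ ψ)
      ?_ fun B hB _ => ?_
    · simp only [ContinuousLinearMap.comp_apply, inner_comp_fourier]
      exact hint.integral_prod_left
    · have hintB := hint.restrict (s := B ×ˢ Set.univ)
      rw [← Measure.prod_restrict, Measure.restrict_univ] at hintB
      calc ∫ l in B, inner ℂ ψ (T (conv f g) l φ) ∂(planch n).toFinite
          = ((Linfty.setIntegralInner B φ ψ).comp T) (conv f g) := rfl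
        _ = ∫ k : Heisenberg n, ∫ l in B, g k * inner ℂ ψ (T f l (rep (l : ℝ) k φ))
              ∂(planch n).toFinite := by
            rw [map_conv]
            refine integral_congr_ae (Eventually.of_forall fun k => ?_)
            simp only [ContinuousLinearMap.comp_apply, Linfty.setIntegralInner_apply]
            rw [← integral_const_mul]
            refine integral_congr_ae (ae_restrict_of_ae ?_)
            rw [ae_toFinite]
            filter_upwards [h_trans k⁻¹ f] with l hl
            rw [hl, adjoint_rep, inv_inv, ContinuousLinearMap.comp_apply]
        _ = ∫ l in B, ∫ k : Heisenberg n, g k * inner ℂ ψ (T f l (rep (l : ℝ) k φ))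
              ∂volume ∂(planch n).toFinite := (integral_integral_swap
            (f := fun (l : RStar) (k : Heisenberg n) =>
              g k * inner ℂ ψ (T f l (rep (l : ℝ) k φ))) hintB).symm
        _ = _ := by simp only [ContinuousLinearMap.comp_apply, inner_comp_fourier]
  have hall := ae_all_iff.2 fun i : ℕ => ae_all_iff.2 fun j : ℕ =>
    key (TopologicalSpace.denseSeq (L2 n) j) (TopologicalSpace.denseSeq (L2 n) i)
  filter_upwards [hall] with l hl
  exact ext_of_inner_denseSeq hl

/-- Where `T f₀` does not vanish, `T g` is the Fourier transform of `g`. The exceptional null sets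
are controlled by letting the group element range over a countable dense set. -/
lemma ae_eq_fourier_of_ne_zero (T : L1 n →L[ℂ] Linfty n)
    (h_conv : ∀ f g : L1 n, ∀ᵐ l ∂(planch n), T (conv f g) l = (T f l).comp (T g l))
    (h_trans : ∀ (h : Heisenberg n) (f : L1 n), ∀ᵐ l ∂(planch n),
      T (rtrans h f) l = (T f l).comp (ContinuousLinearMap.adjoint (rep (l : ℝ) h)))
    (f₀ g : L1 n) :
    ∀ᵐ l ∂(planch n), T f₀ l ≠ 0 → T g l = fourier g (l : ℝ) := by
  let d := TopologicalSpace.denseSeq (Heisenberg n)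
  have h1 := ae_all_iff.2 fun i : ℕ => h_trans (d i) f₀
  have h2 := ae_all_iff.2 fun i : ℕ => h_conv (rtrans (d i) f₀) g
  have h3 := ae_all_iff.2 fun i : ℕ => map_conv_ae_eq_comp_fourier T h_trans (rtrans (d i) f₀) g
  filter_upwards [h1, h2, h3] with l h1 h2 h3 h0
  refine sub_eq_zero.1 (eq_zero_of_comp_rep_comp_eq_zero l.2 h0 fun h v => ?_)
  refine (TopologicalSpace.denseRange_denseSeq (Heisenberg n)).induction_on (p := fun h =>
    T f₀ l (ContinuousLinearMap.adjoint (rep (l : ℝ) h) ((T g l - fourier g (l : ℝ)) v)) = 0)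
    h ?_ fun i => ?_
  · simp only [adjoint_rep]
    exact isClosed_eq ((T f₀ l).continuous.comp
      ((continuous_rep_apply (l : ℝ) _).comp continuous_inv)) continuous_const
  · have h4 := DFunLike.congr_fun ((h2 i).symm.trans (h3 i)) v
    rw [h1 i] at h4
    simp only [ContinuousLinearMap.comp_apply] at h4
    rw [sub_apply, map_sub, map_sub, h4, sub_self]

/-- `T f` vanishes almost everywhere on the set where the images of a dense sequence vanish. -/
lemma ae_eq_zero_of_forall_denseSeq (T : L1 n →L[ℂ] Linfty n) (f : L1 n) :
    ∀ᵐ l ∂(planch n), (∀ i : ℕ, T (TopologicalSpace.denseSeq (L1 n) i) l = 0) → T f l = 0 := by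
  let d := TopologicalSpace.denseSeq (L1 n)
  have h1 := ae_all_iff.2 fun i : ℕ => Linfty.coeFn_sub (T f) (T (d i))
  have h2 := ae_all_iff.2 fun i : ℕ => Linfty.ae_norm_le (T f - T (d i))
  filter_upwards [h1, h2] with l h1 h2 h0
  have h3 : ∀ u : L1 n, ‖T f l‖ ≤ ‖T f - T u‖ := fun u =>
    (TopologicalSpace.denseRange_denseSeq (L1 n)).induction_on
      (p := fun u => ‖T f l‖ ≤ ‖T f - T u‖) u
      (isClosed_le continuous_const (by fun_prop)) fun i => by
        have := h2 i
        rwa [h1 i, h0 i, sub_zero] at this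
  have h4 := h3 f
  rw [sub_self, norm_zero] at h4
  exact norm_le_zero_iff.1 h4

/-- The set where the image of some member of a fixed dense sequence in `L¹(ℍⁿ)` does not
vanish; up to null sets, this is the essential support of `T`. -/
def denseSupport (T : L1 n → Linfty n) : Set RStar :=
  ⋃ i : ℕ, {l | T (TopologicalSpace.denseSeq (L1 n) i) l ≠ 0}

lemma nullMeasurableSet_denseSupport (T : L1 n → Linfty n) :
    NullMeasurableSet (denseSupport T) (planch n) :=
  .iUnion fun _ => nullMeasurableSet_ne_zero _

lemma isEssSupport_toMeasurable_denseSupport (T : L1 n →L[ℂ] Linfty n) :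
    IsEssSupport T (toMeasurable (planch n) (denseSupport T)) := by
  refine ⟨measurableSet_toMeasurable _ _, fun f => ?_, fun B _ hB => ?_⟩
  · filter_upwards [ae_eq_zero_of_forall_denseSeq T f] with l hl hlA
    refine hl fun i => ?_
    by_contra hi
    exact hlA (subset_toMeasurable _ _ (Set.mem_iUnion.2 ⟨i, hi⟩))
  · refine (nullMeasurableSet_denseSupport T).toMeasurable_ae_eq.le.trans ?_
    filter_upwards [ae_all_iff.2 fun i : ℕ => hB (TopologicalSpace.denseSeq (L1 n) i)]
      with l hl hlA
    obtain ⟨i, hi⟩ := Set.mem_iUnion.1 hlA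
    by_contra hlB
    exact hi (hl i hlB)

/-- An essential support is contained, up to a null set, in the set of all `λ` at which some
`T f₀`, with `f₀` in a countable dense set, does not vanish. -/
lemma IsEssSupport.ae_eq_fourier {T : L1 n →L[ℂ] Linfty n}
    (h_conv : ∀ f g : L1 n, ∀ᵐ l ∂(planch n), T (conv f g) l = (T f l).comp (T g l))
    (h_trans : ∀ (h : Heisenberg n) (f : L1 n), ∀ᵐ l ∂(planch n),
      T (rtrans h f) l = (T f l).comp (ContinuousLinearMap.adjoint (rep (l : ℝ) h)))
    {A : Set RStar} (hA : IsEssSupport T A) (f : L1 n) :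
    ∀ᵐ l ∂(planch n), l ∈ A → T f l = fourier f (l : ℝ) := by
  have hsupp := isEssSupport_toMeasurable_denseSupport T
  have hle : A ≤ᵐ[planch n] denseSupport T := (hA.2.2 _ hsupp.1 hsupp.2.1).trans
    (nullMeasurableSet_denseSupport T).toMeasurable_ae_eq.le
  filter_upwards [hle, ae_all_iff.2 fun i : ℕ => ae_eq_fourier_of_ne_zero T h_conv h_trans
    (TopologicalSpace.denseSeq (L1 n) i) f] with l hl h hlA
  obtain ⟨i, hi⟩ := Set.mem_iUnion.1 (hl hlA)
  exact h i hi

end Heisenberg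

theorem theorem4p2 (n : ℕ) (T : Heisenberg.L1 n →L[ℂ] Heisenberg.Linfty n) (hT : T ≠ 0)
    (h_adj : ∀ f : Heisenberg.L1 n, ∀ᵐ l ∂(Heisenberg.planch n),
      T (Heisenberg.invol f) l = ContinuousLinearMap.adjoint (T f l))
    (h_conv : ∀ f g : Heisenberg.L1 n, ∀ᵐ l ∂(Heisenberg.planch n),
      T (Heisenberg.conv f g) l = (T f l).comp (T g l))
    (h_trans : ∀ (h : Heisenberg n) (f : Heisenberg.L1 n), ∀ᵐ l ∂(Heisenberg.planch n),
      T (Heisenberg.rtrans h f) l =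
        (T f l).comp (ContinuousLinearMap.adjoint (Heisenberg.rep (l : ℝ) h))) :
    -- `A` as a subset of `ℝ*` determined up to null sets, identities almost everywhere
    ((∃ A : Set Heisenberg.RStar, Heisenberg.IsEssSupport T A) ∧
      ∀ A : Set Heisenberg.RStar, Heisenberg.IsEssSupport T A →
        ∀ f : Heisenberg.L1 n, ∀ᵐ l ∂(Heisenberg.planch n),
          l ∈ A → T f l = Heisenberg.fourier f (l : ℝ)) ∧
    -- everywhere defined values `S f λ` of `T f`, identities for every `λ`
    (∀ S : Heisenberg.L1 n →ₗ[ℂ] (Heisenberg.RStar → Heisenberg.Op n),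
      (∀ f, T f =ᵐ[Heisenberg.planch n] S f) →
      (∀ f l, S (Heisenberg.invol f) l = ContinuousLinearMap.adjoint (S f l)) →
      (∀ f g l, S (Heisenberg.conv f g) l = (S f l).comp (S g l)) →
      (∀ (h : Heisenberg n) f l, S (Heisenberg.rtrans h f) l =
        (S f l).comp (ContinuousLinearMap.adjoint (Heisenberg.rep (l : ℝ) h))) →
      ∀ l ∈ {l : Heisenberg.RStar | ∃ f, S f l ≠ 0}, ∀ f,
        S f l = Heisenberg.fourier f (l : ℝ)) := by
  refine ⟨⟨⟨_, Heisenberg.isEssSupport_toMeasurable_denseSupport T⟩, fun A hA f =>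
    hA.ae_eq_fourier h_conv h_trans f⟩, ?_⟩
  rintro S - hadj hconv htrans l ⟨f₀, hf₀⟩ f
  exact Heisenberg.eq_fourier_of_hom l.2 ((LinearMap.proj l).comp S) (fun f => hadj f l)
    (fun f g => hconv f g l) (fun h f => htrans h f l) hf₀ f
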